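/- There is an absolute constant $C > 0$ such that the following holds. Let $n \ge 1$, $d \ge 1$ and $m \ge n^2$ be integers, and let $\mathcal D$ be a probability distribution on a finite or countably infinite set $\mathcal K$ of keys in which every key has probability at most $\frac{1}{5n}$. Choose $d$ independent uniformly random hash functions $h_1, \dots, h_d \colon \mathcal K \to \{1, \dots, n\}$ (so that all the values $h_i(k)$ are independent and uniform) and, independently of them, an i.i.d. sequence of keys $k_1, k_2, \dots$ with law $\mathcal D$. In the Greedy-$d$ process (partial key grouping) on $n$ initially empty bins, the $t$-th ball is placed in a bin of minimum current load among $h_1(k_t), \dots, h_d(k_t)$; ties are broken by an arbitrary rule, deterministic or randomized, that depends only on the bins of the earlier balls, on the choices $h_1(k_t), \dots, h_d(k_t)$ and possibly on randomness independent of the hash functions and the keys. Let $L_j(m)$ be the number of balls in bin $j$ after $m$ steps, and let $$ I(m) = \max_{1 \le j \le n} L_j(m) - \frac1n \sum_{j=1}^n L_j(m) $$ be the imbalance. Then, with probability at least $1 - \frac1n$ over the hash functions, the keys and the tie-breaking, $$ I(m) \le C \cdot \frac{m}{n} \cdot \frac{\ln n}{\ln\ln n} \quad \text{if } d = 1 \text{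 and } n \ge 3, $$ and $$ I(m) \le C \cdot \frac{m}{n} \quad \text{if } d \ge 2. $$ -/

import Mathlib

open MeasureTheory ProbabilityTheory

universe u v

namespace PartialKeyGrouping

/-- The load of bin `j` when `hist` is the list of the bins that received the balls so far. -/
def load {n : ℕ} (hist : List (Fin n)) (j : Fin n) : ℕ :=
  hist.count j

/-- The imbalance: maximum load minus average load, over all `n` bins. -/
noncomputable def imbalance {n : ℕ} (hist : List (Fin n)) : ℝ :=
  ((Finset.univ.sup (load hist) : ℕ) : ℝ) - (∑ j : Fin n, (load hist j : ℝ)) / (n : ℝ)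

/-- `T` is a version of `argmin` for `d` choices: given the bins `hist` that received the balls so
far and the choices `c 0, …, c (d - 1)` of the current ball, `T hist c` is one of these choices and
its current load is minimal among them. Ties may be resolved in any way. -/
def IsArgminRule {n d : ℕ} (T : List (Fin n) → (Fin d → Fin n) → Fin n) : Prop :=
  ∀ (hist : List (Fin n)) (c : Fin d → Fin n),
    (∃ i, T hist c = c i) ∧ ∀ i, load hist (T hist c) ≤ load hist (c i)

/-- The bins (latest first) that receive the first `t` balls in the Greedy-`d` process with hash
functions `h 0, …, h (d - 1)`, keys `x 0, x 1, …` and argmin rule `T`. -/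
def greedy {n d : ℕ} {κ : Type u} (T : List (Fin n) → (Fin d → Fin n) → Fin n)
    (h : Fin d → κ → Fin n) (x : ℕ → κ) : ℕ → List (Fin n)
  | 0 => []
  | t + 1 => T (greedy T h x t) (fun i => h i (x t)) :: greedy T h x t

/-- The random input of the Greedy-`d` process on `n` bins, as random variables on `(Ω, P)`:
`d` independent uniformly random hash functions `H i : κ → Fin n`, an i.i.d. sequence of keys `X t`
with law `p` that is independent of the hash functions, and a (deterministic or randomized) way `T`
of taking the argmin whose randomness is independent of the hash functions and the keys. -/
structure IsGreedyInput {n d : ℕ} {κ : Type u} [MeasurableSpace κ] (p : PMF κ)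
    {Ω : Type v} [MeasurableSpace Ω] (P : Measure Ω)
    (H : Fin d → κ → Ω → Fin n) (X : ℕ → Ω → κ)
    (T : List (Fin n) → (Fin d → Fin n) → Ω → Fin n) : Prop where
  measurable_hash : ∀ i k, Measurable (H i k)
  hash_uniform : ∀ i k (b : Fin n), P.real {ω | H i k ω = b} = 1 / (n : ℝ)
  hash_indep : iIndepFun (fun (ik : Fin d × κ) => H ik.1 ik.2) P
  measurable_key : ∀ t, Measurable (X t)
  key_law : ∀ t, P.map (X t) = p.toMeasure
  key_indep : iIndepFun X P
  hash_key_indep : IndepFun (fun ω i k => H i k ω) (fun ω t => X t ω) P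
  measurable_rule : ∀ hist c, Measurable (T hist c)
  isArgminRule : ∀ ω, IsArgminRule (fun hist c => T hist c ω)
  rule_indep : IndepFun (fun ω hist c => T hist c ω)
    (fun ω => ((fun i k => H i k ω), (fun t => X t ω))) P

/-- The imbalance `I(m)` after `m` steps of the Greedy-`d` process, as a random variable. -/
noncomputable def greedyImbalance {n d : ℕ} {κ : Type u} {Ω : Type v}
    (H : Fin d → κ → Ω → Fin n) (X : ℕ → Ω → κ)
    (T : List (Fin n) → (Fin d → Fin n) → Ω → Fin n) (m : ℕ) (ω : Ω) : ℝ :=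
  imbalance (greedy (fun hist c => T hist c ω) (fun i k => H i k ω) (fun t => X t ω) m)

end PartialKeyGrouping

/-! Split the randomness: show that the hash functions are good with high probability, then run the
process with good hash functions and fresh keys. Good means `IsSpread` with `δ = c / n`: the keys
whose choices all lie in `S` have mass at most `c * #S / n`.

For spread hash functions, a ball lands in a bin of load above `l` only if all its choices lie in
the level set of bins with load above `l`, which has probability at most `δ` times the size of that
set. Summing over levels with weights `2 ^ l`, one step multiplies the expected potential `∑ j, 2 ^
load j` by at most `1 + δ` (`tsum_potential_cons_le`), so after `m` steps it is at most `(1 + c / n)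
^ m * n` (`IsGreedyInput.lintegral_potential_le`). By Markov the maximum load is `O((c + 1) * m /
n)` with high probability; `m ≥ n ^ 2` absorbs the polynomial factors in `n`. The average load is
simply dropped.

Spreadness comes from a Chernoff bound for the mass captured by a fixed `S`
(`IsGreedyInput.captured_mass_tail`) and a union bound. For one choice, singletons suffice and `c =
2 * ln n / ln ln n`. For two or more choices, a key is captured with probability at most `(#S / n) ^
2`, which beats the number of sets of each size, and `c = 3` works. -/

namespace PartialKeyGrouping

open scoped ENNReal

/-! ### Chernoff bounds for the mass of a random set of keys. -/

/-- Independence of events is inherited by intersections over disjoint finite blocks. -/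
lemma iIndepSet_iInter {ι κ Ω : Type*} [Fintype ι] [MeasurableSpace Ω] {P : Measure Ω}
    [IsProbabilityMeasure P] {A : ι × κ → Set Ω} (hA : ∀ x, MeasurableSet (A x))
    (hind : iIndepSet A P) : iIndepSet (fun k => ⋂ i, A (i, k)) P := by
  classical
  have h := (iIndepSet_iff_meas_biInter hA).1 hind
  rw [iIndepSet_iff_meas_biInter (fun k => MeasurableSet.iInter fun i => hA _)]
  intro F
  have h1 : ∀ F : Finset κ, P (⋂ k ∈ F, ⋂ i, A (i, k)) = ∏ k ∈ F, ∏ i, P (A (i, k)) := by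
    intro F
    have h2 := h (Finset.univ ×ˢ F)
    rw [Finset.prod_product_right] at h2
    rw [← h2]
    congr 1
    ext ω
    simp only [Set.mem_iInter, Finset.mem_product, Finset.mem_univ, true_and, Prod.forall]
    exact ⟨fun hh i k hk => hh k hk i, fun hh k hk i => hh i k hk⟩
  rw [h1]
  refine Finset.prod_congr rfl fun k _ => ?_
  simpa using (h1 {k}).symm

/-- Moment generating function of a rescaled indicator with small weight. -/
lemma mgf_indicator_le {Ω : Type*} [MeasurableSpace Ω] {P : Measure Ω} [IsProbabilityMeasure P]
    {E : Set Ω} (hE : MeasurableSet E) {r t w : ℝ} (hr : P.real E ≤ r)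
    (hw0 : 0 ≤ w) (hw1 : w ≤ 1) :
    mgf (E.indicator fun _ => w) P t ≤ Real.exp (r * Real.exp t * w) := by
  have hr0 : 0 ≤ r := measureReal_nonneg.trans hr
  have hEq : (fun ω => Real.exp (t * E.indicator (fun _ => w) ω))
      = fun ω => 1 + E.indicator (fun _ => Real.exp (t * w) - 1) ω := by
    funext ω
    by_cases h : ω ∈ E <;> simp [h]
  -- Bernoulli's inequality `(1 + s) ^ w ≤ 1 + w * s` with `s = exp t - 1`; this needs `w ≤ 1`.
  have hbern : Real.exp (t * w) ≤ 1 + w * (Real.exp t - 1) := by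
    have := rpow_one_add_le_one_add_mul_self (s := Real.exp t - 1)
      (by linarith [Real.exp_pos t]) hw0 hw1
    rwa [add_sub_cancel, ← Real.exp_mul] at this
  have hb : Real.exp (t * w) - 1 ≤ w * Real.exp t := by linarith
  have hint : mgf (E.indicator fun _ => w) P t = 1 + P.real E * (Real.exp (t * w) - 1) := by
    unfold mgf
    rw [hEq, integral_add (integrable_const _) ((integrable_const _).indicator hE),
      integral_indicator_const _ hE]
    simp
  rw [hint]
  have h1 : P.real E * (Real.exp (t * w) - 1) ≤ P.real E * (w * Real.exp t) :=
    mul_le_mul_of_nonneg_left hb measureReal_nonneg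
  have h2 : P.real E * (w * Real.exp t) ≤ r * (w * Real.exp t) :=
    mul_le_mul_of_nonneg_right hr (by positivity)
  have h3 := Real.add_one_le_exp (r * Real.exp t * w)
  nlinarith

/-- Chernoff bound for a finite weighted sum of independent indicators. -/
lemma chernoff_finset {κ Ω : Type*} [MeasurableSpace Ω] {P : Measure Ω}
    [IsProbabilityMeasure P] {E : κ → Set Ω} (hE : ∀ k, MeasurableSet (E k))
    (hind : iIndepSet E P) {w : κ → ℝ} (hw0 : ∀ k, 0 ≤ w k) (hw1 : ∀ k, w k ≤ 1) {r t N : ℝ}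
    (hr : ∀ k, P.real (E k) ≤ r) (hr0 : 0 ≤ r) (ht : 0 ≤ t) (F : Finset κ)
    (hF : ∑ k ∈ F, w k ≤ N) (R : ℝ) :
    P.real {ω | R ≤ ∑ k ∈ F, (E k).indicator (fun _ => w k) ω} ≤
      Real.exp (N * r * Real.exp t - t * R) := by
  have hX : iIndepFun (fun k => (E k).indicator fun _ => w k) P := by
    have h1 : iIndepFun (fun k => (E k).indicator fun _ => (1 : ℝ)) P := hind.iIndepFun_indicator
    have h2 := h1.comp (fun k (x : ℝ) => w k * x) (fun k => measurable_const_mul _)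
    convert h2 using 2 with k
    funext ω
    by_cases h : ω ∈ E k <;> simp [h]
  have hmeas : ∀ k, Measurable ((E k).indicator fun _ => w k) :=
    fun k => measurable_const.indicator (hE k)
  have hmgf := hX.mgf_sum (t := t) hmeas F
  have hint : Integrable (fun ω => Real.exp (t * (∑ k ∈ F, (E k).indicator fun _ => w k) ω)) P := by
    refine hX.integrable_exp_mul_sum hmeas fun k _ => ?_
    refine Integrable.of_bound (by fun_prop) (Real.exp t) (Filter.Eventually.of_forall fun ω => ?_)
    rw [Real.norm_of_nonneg (Real.exp_nonneg _)]
    refine Real.exp_le_exp.2 (mul_le_of_le_one_right ht ?_)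
    by_cases h : ω ∈ E k <;> simp [h, hw1]
  have h := measure_ge_le_exp_mul_mgf R ht hint
  simp only [Finset.sum_apply] at h
  refine h.trans ?_
  rw [hmgf]
  have hprod : ∏ k ∈ F, mgf ((E k).indicator fun _ => w k) P t
      ≤ Real.exp (N * r * Real.exp t) := by
    calc ∏ k ∈ F, mgf ((E k).indicator fun _ => w k) P t
        ≤ ∏ k ∈ F, Real.exp (r * Real.exp t * w k) :=
          Finset.prod_le_prod (fun _ _ => mgf_nonneg)
            fun k _ => mgf_indicator_le (hE k) (hr k) (hw0 k) (hw1 k)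
      _ = Real.exp (r * Real.exp t * ∑ k ∈ F, w k) := by
          rw [← Real.exp_sum, Finset.mul_sum]
      _ ≤ _ := by
          refine Real.exp_le_exp.2 ?_
          have := mul_le_mul_of_nonneg_left hF (mul_nonneg hr0 (Real.exp_nonneg t))
          linarith
  calc Real.exp (-t * R) * ∏ k ∈ F, mgf ((E k).indicator fun _ => w k) P t
      ≤ Real.exp (-t * R) * Real.exp (N * r * Real.exp t) :=
        mul_le_mul_of_nonneg_left hprod (Real.exp_nonneg _)
    _ = _ := by rw [← Real.exp_add]; congr 1; ring

/-- Chernoff bound for the mass of the random set of keys `k` whose event `E k` occurs. -/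
lemma chernoff_pmf {κ Ω : Type*} [Countable κ] [MeasurableSpace κ] [MeasurableSingletonClass κ]
    [MeasurableSpace Ω] {P : Measure Ω} [IsProbabilityMeasure P] (p : PMF κ)
    {E : κ → Set Ω} (hE : ∀ k, MeasurableSet (E k)) (hind : iIndepSet E P) {r t N : ℝ}
    (hN : 0 < N) (hp : ∀ k, (p k).toReal ≤ 1 / N)
    (hr : ∀ k, P.real (E k) ≤ r) (hr0 : 0 ≤ r) (ht : 0 ≤ t) (R : ℝ) :
    P {ω | ENNReal.ofReal (R / N) < p.toMeasure {k | ω ∈ E k}} ≤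
      ENNReal.ofReal (Real.exp (N * r * Real.exp t - t * R)) := by
  classical
  -- The rescaled weights lie in `[0, 1]` and have total at most `N`.
  set w : κ → ℝ := fun k => N * (p k).toReal with hw
  have hw0 : ∀ k, 0 ≤ w k := fun k => by positivity
  have hw1 : ∀ k, w k ≤ 1 := fun k => by
    have := mul_le_mul_of_nonneg_left (hp k) hN.le
    rwa [mul_one_div_cancel hN.ne'] at this
  have hwF : ∀ F : Finset κ, ∑ k ∈ F, w k ≤ N := fun F => by
    have h1 : ∑ k ∈ F, (p k).toReal ≤ 1 := by
      rw [← ENNReal.toReal_sum fun k _ => p.apply_ne_top k]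
      refine ENNReal.toReal_le_of_le_ofReal zero_le_one ?_
      rw [ENNReal.ofReal_one, ← p.tsum_coe]
      exact ENNReal.sum_le_tsum F
    rw [hw, ← Finset.mul_sum]
    exact mul_le_of_le_one_right hN.le h1
  set B : Finset κ → Set Ω := fun F =>
    {ω | ENNReal.ofReal (R / N) < ∑ k ∈ F, {k | ω ∈ E k}.indicator p k} with hB
  -- The inequality is strict, so an infinite sum exceeds the threshold iff some finite partial sum
  -- does; the finite bound then passes to the directed union.
  have hset : {ω | ENNReal.ofReal (R / N) < p.toMeasure {k | ω ∈ E k}} = ⋃ F, B F := by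
    ext ω
    simp only [hB, Set.mem_ofPred_eq, Set.mem_iUnion]
    rw [p.toMeasure_apply_eq_tsum, ENNReal.tsum_eq_iSup_sum, lt_iSup_iff]
  have hdir : Directed (· ⊆ ·) B := by
    refine Monotone.directed_le fun F G hFG ω hω => ?_
    exact lt_of_lt_of_le (Set.mem_ofPred.1 hω) (Finset.sum_le_sum_of_subset hFG)
  rw [hset, hdir.measure_iUnion]
  refine iSup_le fun F => ?_
  have hsub : B F ⊆ {ω | R ≤ ∑ k ∈ F, (E k).indicator (fun _ => w k) ω} := by
    intro ω hω
    have hfin : ∀ k ∈ F, {k | ω ∈ E k}.indicator p k ≠ ∞ := fun k _ => by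
      by_cases h : ω ∈ E k <;> simp [h, p.apply_ne_top]
    have h2 : R / N < (∑ k ∈ F, {k | ω ∈ E k}.indicator p k).toReal := by
      by_cases hneg : R / N < 0
      · exact hneg.trans_le ENNReal.toReal_nonneg
      · exact (ENNReal.ofReal_lt_iff_lt_toReal (not_lt.1 hneg)
          (ENNReal.sum_ne_top.2 hfin)).1 hω
    rw [ENNReal.toReal_sum hfin, div_lt_iff₀ hN, Finset.sum_mul] at h2
    refine h2.le.trans (Finset.sum_le_sum fun k _ => ?_)
    by_cases h : ω ∈ E k <;> simp [h, hw, mul_comm]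
  refine (measure_mono hsub).trans ?_
  rw [← ofReal_measureReal]
  exact ENNReal.ofReal_le_ofReal (chernoff_finset hE hind hw0 hw1 hr hr0 ht F (hwF F) R)

/-! ### Independence and averaging over a fresh key. -/

/-- If `A` is independent of `B` and `C` of the pair `(A, B)`, then `(C, A)` is independent
of `B`. -/
lemma indepFun_prodMk_left {Ω α β γ : Type*} [MeasurableSpace Ω] [MeasurableSpace α]
    [MeasurableSpace β] [MeasurableSpace γ] {P : Measure Ω} [IsProbabilityMeasure P]
    {A : Ω → α} {B : Ω → β} {C : Ω → γ} (hA : Measurable A) (hB : Measurable B)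
    (hC : Measurable C) (hAB : IndepFun A B P) (hCAB : IndepFun C (fun ω => (A ω, B ω)) P) :
    IndepFun (fun ω => (C ω, A ω)) B P := by
  have hCA : IndepFun C A P := hCAB.comp measurable_id measurable_fst
  rw [indepFun_iff_map_prod_eq_prod_map_map (by fun_prop) (by fun_prop)] at hAB hCAB hCA ⊢
  have : IsProbabilityMeasure (P.map A) := Measure.isProbabilityMeasure_map hA.aemeasurable
  have : IsProbabilityMeasure (P.map B) := Measure.isProbabilityMeasure_map hB.aemeasurable
  have : IsProbabilityMeasure (P.map C) := Measure.isProbabilityMeasure_map hC.aemeasurable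
  rw [hCA]
  rw [hAB] at hCAB
  refine (MeasurableEquiv.prodAssoc.map_measurableEquiv_injective) ?_
  rw [Measure.prodAssoc_prod, ← hCAB, Measure.map_map (by fun_prop) (by fun_prop)]
  rfl

/-- Freezing: a key with law `p` may be averaged out of a function of an independent past. -/
lemma lintegral_freeze {Ω κ : Type*} [Countable κ] [MeasurableSpace κ]
    [MeasurableSingletonClass κ] {m mΩ : MeasurableSpace Ω} (hm : m ≤ mΩ) {P : Measure Ω}
    {p : PMF κ} {Y : Ω → κ} (hY : Measurable Y) (hlaw : P.map Y = p.toMeasure)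
    (hind : Indep m (MeasurableSpace.comap Y inferInstance) P) {f : κ → Ω → ℝ≥0∞}
    (hf : ∀ k, Measurable[m] (f k)) :
    ∫⁻ ω, f (Y ω) ω ∂P = ∫⁻ ω, ∑' k, p k * f k ω ∂P := by
  classical
  have hf' : ∀ k, Measurable (f k) := fun k => (hf k).mono hm le_rfl
  have hsing : ∀ k, MeasurableSet (Y ⁻¹' {k}) := fun k => hY (measurableSet_singleton k)
  have h1 : ∀ ω, f (Y ω) ω = ∑' k, f k ω * (Y ⁻¹' {k}).indicator (fun _ => 1) ω := by
    intro ω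
    rw [tsum_eq_single (Y ω)]
    · simp
    · intro k hk
      simp [Ne.symm hk]
  simp_rw [h1]
  rw [lintegral_tsum fun k => ((hf' k).fun_mul (measurable_const.indicator (hsing k))).aemeasurable,
    lintegral_tsum fun k => ((hf' k).const_mul _).aemeasurable]
  refine tsum_congr fun k => ?_
  have hYm : Measurable[MeasurableSpace.comap Y inferInstance]
      ((Y ⁻¹' {k}).indicator fun _ => (1 : ℝ≥0∞)) :=
    Measurable.indicator measurable_const ⟨{k}, measurableSet_singleton k, rfl⟩
  rw [lintegral_mul_eq_lintegral_mul_lintegral_of_independent_measurableSpace hm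
    hY.comap_le hind (hf k) hYm, lintegral_indicator_const (hsing k), one_mul,
    lintegral_const_mul _ (hf' k), mul_comm, ← Measure.map_apply hY (measurableSet_singleton k),
    hlaw, PMF.toMeasure_apply_singleton _ _ (measurableSet_singleton k)]

/-! ### Spread hash families and the one-step growth of the potential. -/

/-- A hash family is `δ`-spread if every set `S` of bins captures mass at most `δ * #S`, where a
key is captured if all its choices are in `S`. -/
def IsSpread {n d : ℕ} {κ : Type*} [MeasurableSpace κ] (p : PMF κ) (δ : ℝ≥0∞)
    (h : Fin d → κ → Fin n) : Prop :=
  ∀ S : Finset (Fin n), p.toMeasure {k | ∀ i, h i k ∈ S} ≤ δ * S.card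

/-- The exponential potential of a list of bins. -/
noncomputable def potential {n : ℕ} (hist : List (Fin n)) : ℝ≥0∞ :=
  ∑ j, 2 ^ load hist j

lemma two_pow_eq_layers {L M : ℕ} (h : L ≤ M) :
    (2 : ℝ≥0∞) ^ L = 1 + ∑ l ∈ Finset.range M, 2 ^ l * (if l < L then 1 else 0) := by
  have h1 : ∑ l ∈ Finset.range M, (2 : ℝ≥0∞) ^ l * (if l < L then 1 else 0)
      = ∑ l ∈ Finset.range L, 2 ^ l := by
    simp_rw [mul_ite, mul_one, mul_zero, ← Finset.sum_filter]
    congr 1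
    ext l
    simp only [Finset.mem_filter, Finset.mem_range]
    omega
  have h2 : 1 + ∑ l ∈ Finset.range L, 2 ^ l = 2 ^ L := by
    have := Nat.geomSum_eq (le_refl 2) L
    have := Nat.one_le_two_pow (n := L)
    simp_all
  rw [h1]
  exact_mod_cast h2.symm

/-- The argmin has load above `l` only if every choice does, so spreadness applied to the level set
`{j | l < load hist j}` bounds each layer of `2 ^ load`. -/
lemma tsum_two_pow_load_le {n d : ℕ} {κ : Type*} [Countable κ] [MeasurableSpace κ]
    [MeasurableSingletonClass κ] {p : PMF κ} {δ : ℝ≥0∞} {h : Fin d → κ → Fin n}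
    (hh : IsSpread p δ h) {T : List (Fin n) → (Fin d → Fin n) → Fin n} (hT : IsArgminRule T)
    (hist : List (Fin n)) :
    ∑' k, p k * 2 ^ load hist (T hist fun i => h i k) ≤ δ * potential hist := by
  classical
  have hM : ∀ j, load hist j ≤ hist.length := fun j => List.count_le_length
  have hlayer : ∀ l, ∑' k, p k * (if l < load hist (T hist fun i => h i k) then 1 else 0)
      ≤ δ * ∑ j, if l < load hist j then 1 else 0 := by
    intro l
    have h1 := hh (Finset.univ.filter fun j => l < load hist j)
    rw [p.toMeasure_apply_eq_tsum] at h1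
    rw [Finset.sum_boole]
    refine le_trans (ENNReal.tsum_le_tsum fun k => ?_) h1
    by_cases hk : l < load hist (T hist fun i => h i k)
    · have hmem : k ∈ {k | ∀ i, h i k ∈ Finset.univ.filter fun j => l < load hist j} := by
        intro i
        simpa using hk.trans_le ((hT hist fun i => h i k).2 i)
      rw [Set.indicator_of_mem hmem, if_pos hk, mul_one]
    · simp [hk]
  -- The whole set of bins captures every key, so `1 ≤ δ * n`; this pays for the constant term of
  -- the layer decomposition.
  have huniv : 1 ≤ δ * ∑ _j : Fin n, 1 := by
    have h1 := hh Finset.univ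
    simpa using h1
  have hL : ∑' k, p k * 2 ^ load hist (T hist fun i => h i k)
      = 1 + ∑ l ∈ Finset.range hist.length, 2 ^ l *
        ∑' k, p k * (if l < load hist (T hist fun i => h i k) then 1 else 0) := by
    simp_rw [fun k => two_pow_eq_layers (hM (T hist fun i => h i k)), mul_add, mul_one,
      Finset.mul_sum]
    rw [ENNReal.tsum_add, p.tsum_coe, Summable.tsum_finsetSum fun _ _ => ENNReal.summable]
    simp_rw [← ENNReal.tsum_mul_left]
    congr 1
    refine Finset.sum_congr rfl fun l _ => tsum_congr fun k => ?_
    ring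
  have hR : δ * potential hist = δ * ∑ _j : Fin n, 1 + ∑ l ∈ Finset.range hist.length, 2 ^ l *
      (δ * ∑ j, if l < load hist j then 1 else 0) := by
    unfold potential
    simp_rw [fun j => two_pow_eq_layers (hM j), Finset.sum_add_distrib, mul_add]
    rw [Finset.sum_comm]
    simp_rw [Finset.mul_sum]
    congr 1
    refine Finset.sum_congr rfl fun l _ => Finset.sum_congr rfl fun j _ => ?_
    ring
  rw [hL, hR]
  gcongr with l _
  exact hlayer l

lemma potential_cons {n : ℕ} (b : Fin n) (hist : List (Fin n)) :
    potential (b :: hist) = potential hist + 2 ^ load hist b := by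
  classical
  unfold potential load
  rw [← Finset.sum_erase_add _ _ (Finset.mem_univ b),
    ← Finset.sum_erase_add (s := Finset.univ) (f := fun j => (2 : ℝ≥0∞) ^ hist.count j) (h := Finset.mem_univ b),
    List.count_cons_self, add_assoc, pow_succ, mul_two]
  congr 1
  refine Finset.sum_congr rfl fun j hj => ?_
  rw [List.count_cons_of_ne (Finset.ne_of_mem_erase hj).symm]

lemma tsum_potential_cons_le {n d : ℕ} {κ : Type*} [Countable κ] [MeasurableSpace κ]
    [MeasurableSingletonClass κ] {p : PMF κ} {δ : ℝ≥0∞} {h : Fin d → κ → Fin n}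
    (hh : IsSpread p δ h) {T : List (Fin n) → (Fin d → Fin n) → Fin n} (hT : IsArgminRule T)
    (hist : List (Fin n)) :
    ∑' k, p k * potential (T hist (fun i => h i k) :: hist) ≤ (1 + δ) * potential hist := by
  simp_rw [potential_cons, mul_add, ENNReal.tsum_add, ENNReal.tsum_mul_right, p.tsum_coe, add_mul]
  gcongr
  exact tsum_two_pow_load_le hh hT hist

/-! ### Measurability of the process. -/

lemma measurableSet_isSpread {n d : ℕ} {κ Ω : Type*} [Countable κ] [MeasurableSpace κ]
    [MeasurableSingletonClass κ] (p : PMF κ) (δ : ℝ≥0∞) [MeasurableSpace Ω]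
    {H : Fin d → κ → Ω → Fin n} (hH : ∀ i k, Measurable (H i k)) :
    MeasurableSet {ω | IsSpread p δ fun i k => H i k ω} := by
  classical
  have : {ω | IsSpread p δ fun i k => H i k ω}
      = ⋂ S : Finset (Fin n), {ω | p.toMeasure {k | ∀ i, H i k ω ∈ S} ≤ δ * S.card} := by
    ext ω
    simp [IsSpread]
  rw [this]
  refine MeasurableSet.iInter fun S => measurableSet_le ?_ measurable_const
  simp_rw [p.toMeasure_apply_eq_tsum]
  refine Measurable.tsum fun k => ?_
  have h1 : (fun ω => {k | ∀ i, H i k ω ∈ S}.indicator p k)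
      = (⋂ i, H i k ⁻¹' (S : Set (Fin n))).indicator fun _ => p k := by
    funext ω
    simp [Set.indicator_apply]
  rw [h1]
  exact measurable_const.indicator
    (MeasurableSet.iInter fun i => hH i k (Set.toFinite _).measurableSet)

/-- With the discrete σ-algebra, every function of the history is measurable; histories form a
countable type. -/
instance (n : ℕ) : MeasurableSpace (List (Fin n)) := ⊤

lemma measurable_potential {n : ℕ} : Measurable (potential (n := n)) :=
  measurable_from_top

lemma measurable_rule_cons {n d : ℕ} {Ω : Type*} [MeasurableSpace Ω]
    {T : List (Fin n) → (Fin d → Fin n) → Ω → Fin n} (hT : ∀ hist c, Measurable (T hist c))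
    {hist : Ω → List (Fin n)} (hhist : Measurable hist) {c : Ω → Fin d → Fin n}
    (hc : Measurable c) : Measurable fun ω => T (hist ω) (c ω) ω :: hist ω := by
  have h1 : Measurable fun x : Ω × (List (Fin n) × (Fin d → Fin n)) =>
      T x.2.1 x.2.2 x.1 :: x.2.1 := by
    refine measurable_from_prod_countable_left fun ⟨l, b⟩ => ?_
    have h2 : Measurable fun b : Fin n => b :: l := measurable_from_top
    exact h2.comp (hT l b)
  exact h1.comp (measurable_id.prodMk (hhist.prodMk hc))

lemma measurable_greedy {n d : ℕ} {κ Ω : Type*} [Countable κ] [MeasurableSpace κ]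
    [MeasurableSingletonClass κ] [MeasurableSpace Ω] {H : Fin d → κ → Ω → Fin n} {X : ℕ → Ω → κ}
    {T : List (Fin n) → (Fin d → Fin n) → Ω → Fin n} (hH : ∀ i k, Measurable (H i k))
    (hT : ∀ hist c, Measurable (T hist c)) (t : ℕ) (hX : ∀ s < t, Measurable (X s)) :
    Measurable fun ω =>
      greedy (fun hist c => T hist c ω) (fun i k => H i k ω) (fun s => X s ω) t := by
  induction t with
  | zero => exact measurable_const
  | succ t ih =>
    have h1 := ih fun s hs => hX s (hs.trans t.lt_succ_self)
    have h2 := hX t t.lt_succ_self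
    have h3 : Measurable fun ω i => H i (X t ω) ω := by
      refine measurable_pi_lambda _ fun i => ?_
      have h4 : Measurable fun x : Ω × κ => H i x.2 x.1 :=
        measurable_from_prod_countable_left fun k => hH i k
      exact h4.comp (measurable_id.prodMk h2)
    exact measurable_rule_cons hT h1 h3

/-! ### Expected potential along the process, and the resulting imbalance bound. -/

section Loads

variable {n d : ℕ} {κ : Type u} [MeasurableSpace κ] {p : PMF κ} {Ω : Type v} [MeasurableSpace Ω] {P : Measure Ω}
  [IsProbabilityMeasure P] {H : Fin d → κ → Ω → Fin n} {X : ℕ → Ω → κ}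
  {T : List (Fin n) → (Fin d → Fin n) → Ω → Fin n}

/-- The next key is independent of the tie-breaking rule, the hash functions and the earlier
keys. -/
lemma IsGreedyInput.indepFun_past (hin : IsGreedyInput p P H X T) (t : ℕ) :
    IndepFun (fun ω => ((fun hist c => T hist c ω), ((fun i k => H i k ω),
      fun s : Finset.range t => X s ω))) (X t) P := by
  have hXm := hin.measurable_key
  have hHm := hin.measurable_hash
  have hTm := hin.measurable_rule
  have h1 : IndepFun (fun ω (s : Finset.range t) => X s ω) (X t) P := by
    have h := hin.key_indep.indepFun_finset (Finset.range t) {t} (by simp) hXm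
    exact h.comp measurable_id (measurable_pi_apply (⟨t, by simp⟩ : ({t} : Finset ℕ)))
  have hmX : Measurable fun (x : ℕ → κ) => ((fun s : Finset.range t => x s), x t) := by fun_prop
  have h2 := hin.hash_key_indep.comp measurable_id hmX
  have h3 := indepFun_prodMk_left (by fun_prop) (hXm t) (by fun_prop) h1 h2
  have hmHX : Measurable fun (y : (Fin d → κ → Fin n) × (ℕ → κ)) =>
      ((y.1, fun s : Finset.range t => y.2 s), y.2 t) := by fun_prop
  have h4 := hin.rule_indep.comp measurable_id hmHX
  exact indepFun_prodMk_left (by fun_prop) (hXm t) (by fun_prop) h3 h4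

variable [Countable κ] [MeasurableSingletonClass κ]

lemma measurable_frozen_potential {Ω : Type*} [MeasurableSpace Ω] {H : Fin d → κ → Ω → Fin n}
    {X : ℕ → Ω → κ} {T : List (Fin n) → (Fin d → Fin n) → Ω → Fin n} (p : PMF κ) (δ : ℝ≥0∞)
    (hH : ∀ i k, Measurable (H i k)) (hT : ∀ hist c, Measurable (T hist c)) (t : ℕ)
    (hX : ∀ s < t, Measurable (X s)) (k : κ) :
    Measurable ({ω | IsSpread p δ fun i k => H i k ω}.indicator fun ω => potential
      (T (greedy (fun hist c => T hist c ω) (fun i k => H i k ω) (fun s => X s ω) t)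
        (fun i => H i k ω) ω ::
        greedy (fun hist c => T hist c ω) (fun i k => H i k ω) (fun s => X s ω) t)) :=
  Measurable.indicator (measurable_potential.comp (measurable_rule_cons hT
    (measurable_greedy hH hT t hX) (measurable_pi_lambda _ fun i => hH i k)))
    (measurableSet_isSpread p δ hH)

/-- Restricting to the spread event replaces conditioning on the hash functions: the event is
determined by the past, so averaging over the next key gives the factor `1 + δ` pointwise on it. -/
lemma IsGreedyInput.lintegral_potential_le (hin : IsGreedyInput p P H X T) (δ : ℝ≥0∞) (t : ℕ) :
    ∫⁻ ω, {ω | IsSpread p δ fun i k => H i k ω}.indicator (fun ω => potential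
      (greedy (fun hist c => T hist c ω) (fun i k => H i k ω) (fun s => X s ω) t)) ω ∂P
      ≤ (1 + δ) ^ t * n := by
  classical
  induction t with
  | zero =>
    refine (lintegral_mono (g := fun _ => (n : ℝ≥0∞)) fun ω => ?_).trans (by simp)
    refine (Set.indicator_le_self _ _ ω).trans ?_
    simp [potential, greedy, load]
  | succ t ih =>
    set past := fun ω => ((fun hist c => T hist c ω), ((fun i k => H i k ω),
      fun s : Finset.range t => X s ω)) with hpast
    have hXm := hin.measurable_key
    have hHm := hin.measurable_hash
    have hTm := hin.measurable_rule
    have hpm : Measurable past := by fun_prop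
    have hm : Measurable[MeasurableSpace.comap past inferInstance] past := comap_measurable past
    set G := {ω | IsSpread p δ fun i k => H i k ω} with hG
    have hGm : MeasurableSet G := measurableSet_isSpread p δ hHm
    set hist := fun ω =>
      greedy (fun hist c => T hist c ω) (fun i k => H i k ω) (fun s => X s ω) t with hhist
    set f : κ → Ω → ℝ≥0∞ := fun k => G.indicator fun ω =>
      potential (T (hist ω) (fun i => H i k ω) ω :: hist ω) with hf
    -- Measurability is needed for the σ-algebra of the past, not just the ambient one, since it is
    -- the past that is independent of `X t`.
    have hfm : ∀ k, Measurable[MeasurableSpace.comap past inferInstance] (f k) :=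
      @measurable_frozen_potential n d κ _ _ _ Ω (MeasurableSpace.comap past inferInstance)
        H X T p δ
        (fun i k => (show Measurable fun y : (List (Fin n) → (Fin d → Fin n) → Fin n) ×
          ((Fin d → κ → Fin n) × (Finset.range t → κ)) => y.2.1 i k by fun_prop).comp hm)
        (fun hist c => (show Measurable fun y : (List (Fin n) → (Fin d → Fin n) → Fin n) ×
          ((Fin d → κ → Fin n) × (Finset.range t → κ)) => y.1 hist c by fun_prop).comp hm)
        t (fun s hs => (show Measurable fun y : (List (Fin n) → (Fin d → Fin n) → Fin n) ×
          ((Fin d → κ → Fin n) × (Finset.range t → κ)) =>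
            y.2.2 ⟨s, Finset.mem_range.2 hs⟩ by fun_prop).comp hm)
    have key := lintegral_freeze hpm.comap_le (hXm t) (hin.key_law t)
      (hin.indepFun_past t) hfm
    have hstep : ∀ ω, ∑' k, p k * f k ω
        ≤ (1 + δ) * G.indicator (fun ω => potential (hist ω)) ω := by
      intro ω
      by_cases hω : ω ∈ G
      · simp only [hf, Set.indicator_of_mem hω]
        exact tsum_potential_cons_le hω (hin.isArgminRule ω) (hist ω)
      · simp [hf, Set.indicator_of_notMem hω]
    have hgoal : ∀ ω, G.indicator (fun ω => potential (greedy (fun hist c => T hist c ω)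
        (fun i k => H i k ω) (fun s => X s ω) (t + 1))) ω = f (X t ω) ω := fun ω => by
      by_cases hω : ω ∈ G
      · simp only [hf, Set.indicator_of_mem hω]; rfl
      · simp only [hf, Set.indicator_of_notMem hω]
    simp_rw [hgoal]
    rw [key]
    refine (lintegral_mono hstep).trans ?_
    have hpot : Measurable fun ω => potential (hist ω) :=
      measurable_potential.comp (measurable_greedy hHm hTm t fun s _ => hXm s)
    rw [lintegral_const_mul _ (hpot.indicator hGm), pow_succ', mul_assoc]
    gcongr

end Loads

/-- The numerical input to Markov's inequality at the threshold `2 ^ ((2 * c + 3) * (m / n))`: the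
`2 * c` comes from `exp 1 ≤ 4 = 2 ^ 2`, and the `3` from `2 * n ^ 2 ≤ 2 ^ (3 * n)` together with `n
≤ m / n`. -/
lemma potential_rate_bound {n m : ℕ} (hn : 1 ≤ n) (hm : n ^ 2 ≤ m) {c : ℝ} (hc : 0 ≤ c) :
    (1 + c / n) ^ m * n ≤ 1 / (2 * n) * (2 : ℝ) ^ ((2 * c + 3) * ((m : ℝ) / n)) := by
  have hn0 : (0 : ℝ) < n := by exact_mod_cast hn
  set y : ℝ := (m : ℝ) / n with hy
  have hny : (n : ℝ) ≤ y := by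
    rw [hy, le_div_iff₀ hn0]
    have : ((n ^ 2 : ℕ) : ℝ) ≤ m := by exact_mod_cast hm
    push_cast at this
    nlinarith
  have h1 : (1 + c / n) ^ m ≤ (4 : ℝ) ^ (c * y) := by
    calc (1 + c / n) ^ m ≤ Real.exp (c / n) ^ m := by
          gcongr
          linarith [Real.add_one_le_exp (c / n)]
      _ = Real.exp 1 ^ (c * y) := by
          rw [← Real.exp_nat_mul, ← Real.exp_mul]
          congr 1
          rw [hy]
          ring
      _ ≤ _ := by
          apply Real.rpow_le_rpow (Real.exp_nonneg _) _ (by positivity)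
          linarith [Real.exp_one_lt_d9]
  have h2 : 2 * (n : ℝ) * n ≤ (2 : ℝ) ^ (3 * y) := by
    have h3 : (n : ℝ) ≤ 2 ^ n := by exact_mod_cast n.lt_two_pow_self.le
    have h4 : (2 : ℝ) ≤ 2 ^ n := by
      calc (2 : ℝ) = 2 ^ 1 := by norm_num
        _ ≤ 2 ^ n := pow_le_pow_right₀ (by norm_num) hn
    calc 2 * (n : ℝ) * n ≤ 2 ^ n * 2 ^ n * 2 ^ n := by gcongr
      _ = (2 : ℝ) ^ (3 * (n : ℝ)) := by
          rw [← pow_add, ← pow_add, ← Real.rpow_natCast]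
          congr 1
          push_cast
          ring
      _ ≤ _ := by gcongr; norm_num
  have h5 : (2 : ℝ) ^ ((2 * c + 3) * y) = 4 ^ (c * y) * 2 ^ (3 * y) := by
    rw [show (2 * c + 3) * y = 2 * (c * y) + 3 * y by ring, Real.rpow_add (by norm_num),
      Real.rpow_mul (by norm_num)]
    norm_num
  rw [h5]
  calc (1 + c / n) ^ m * n ≤ 4 ^ (c * y) * n := by gcongr
    _ = 1 / (2 * n) * (4 ^ (c * y) * (2 * n * n)) := by field_simp
    _ ≤ _ := by gcongr

section Loads

variable {n d : ℕ} {κ : Type u} [Countable κ] [MeasurableSpace κ]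
  [MeasurableSingletonClass κ] {p : PMF κ} {Ω : Type v} [MeasurableSpace Ω] {P : Measure Ω}
  [IsProbabilityMeasure P] {H : Fin d → κ → Ω → Fin n} {X : ℕ → Ω → κ}
  {T : List (Fin n) → (Fin d → Fin n) → Ω → Fin n}

/-- If the hash functions are spread with high probability, then the imbalance is small with high
probability. -/
lemma IsGreedyInput.imbalance_le_of_isSpread (hin : IsGreedyInput p P H X T) {m : ℕ} (hn : 1 ≤ n)
    (hm : n ^ 2 ≤ m) {c D : ℝ} (hc : 0 ≤ c) (hD : (2 * c + 3) * ((m : ℝ) / n) ≤ D)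
    (hspread : P {ω | ¬ IsSpread p (ENNReal.ofReal (c / n)) fun i k => H i k ω}
      ≤ ENNReal.ofReal (1 / (2 * n))) :
    1 - 1 / (n : ℝ) ≤ P.real {ω | greedyImbalance H X T m ω ≤ D} := by
  have hn0 : (0 : ℝ) < n := by exact_mod_cast hn
  set δ := ENNReal.ofReal (c / n) with hδ
  set G := {ω | IsSpread p δ fun i k => H i k ω} with hG
  set Φ := fun ω => potential
      (greedy (fun hist c => T hist c ω) (fun i k => H i k ω) (fun s => X s ω) m) with hΦ
  set a : ℝ := (2 : ℝ) ^ ((2 * c + 3) * ((m : ℝ) / n)) with ha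
  have ha0 : 0 < a := by positivity
  have hGm : MeasurableSet G := measurableSet_isSpread p δ hin.measurable_hash
  have hΦm : Measurable Φ := measurable_potential.comp
    (measurable_greedy hin.measurable_hash hin.measurable_rule m fun s _ => hin.measurable_key s)
  -- Markov's inequality for the potential on the spread event.
  have h1 : P {ω | ENNReal.ofReal a ≤ G.indicator Φ ω} ≤ ENNReal.ofReal (1 / (2 * n)) := by
    have h2 := mul_meas_ge_le_lintegral (μ := P) (hΦm.indicator hGm) (ENNReal.ofReal a)
    have h3 := h2.trans (hin.lintegral_potential_le δ m)
    have h4 : (1 + δ) ^ m * n ≤ ENNReal.ofReal a * ENNReal.ofReal (1 / (2 * n)) := by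
      rw [hδ, ← ENNReal.ofReal_one, ← ENNReal.ofReal_add zero_le_one (by positivity),
        ← ENNReal.ofReal_pow (by positivity), ← ENNReal.ofReal_natCast n,
        ← ENNReal.ofReal_mul (by positivity), ← ENNReal.ofReal_mul ha0.le]
      refine ENNReal.ofReal_le_ofReal ((potential_rate_bound hn hm hc).trans_eq ?_)
      rw [mul_comm]
    exact (ENNReal.mul_le_mul_iff_right (by simpa using ha0) ENNReal.ofReal_ne_top).1
      (h3.trans h4)
  have hcover : (Set.univ : Set Ω) ⊆ {ω | greedyImbalance H X T m ω ≤ D} ∪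
      ({ω | ¬ IsSpread p δ fun i k => H i k ω} ∪ {ω | ENNReal.ofReal a ≤ G.indicator Φ ω}) := by
    intro ω _
    by_contra hω
    simp only [Set.mem_union, Set.mem_ofPred_eq, not_or, not_not, not_le] at hω
    obtain ⟨hD', hs, hΦ'⟩ := hω
    rw [Set.indicator_of_mem (show ω ∈ G from hs)] at hΦ'
    refine absurd hΦ' (not_lt.2 ?_)
    set hist := greedy (fun hist c => T hist c ω) (fun i k => H i k ω) (fun s => X s ω) m
    have hsup : (2 * c + 3) * ((m : ℝ) / n) ≤ (Finset.univ.sup (load hist) : ℕ) := by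
      -- The average load is nonnegative, so the maximum load dominates the imbalance.
      have h5 : greedyImbalance H X T m ω ≤ (Finset.univ.sup (load hist) : ℕ) :=
        sub_le_self _ (by positivity)
      linarith
    have hpow : a ≤ (2 : ℝ) ^ Finset.univ.sup (load hist) := by
      rw [ha, ← Real.rpow_natCast]
      exact Real.rpow_le_rpow_of_exponent_le (by norm_num) hsup
    have hne : (Finset.univ : Finset (Fin n)).Nonempty := ⟨⟨0, hn⟩, Finset.mem_univ _⟩
    obtain ⟨j, hj, hj'⟩ := Finset.exists_mem_eq_sup _ hne (load hist)
    rw [hj'] at hpow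
    calc ENNReal.ofReal a ≤ ENNReal.ofReal ((2 : ℝ) ^ load hist j) := ENNReal.ofReal_le_ofReal hpow
      _ = 2 ^ load hist j := by rw [ENNReal.ofReal_pow (by norm_num)]; simp
      _ ≤ Φ ω := Finset.single_le_sum (f := fun j => (2 : ℝ≥0∞) ^ load hist j)
          (fun _ _ => zero_le) hj
  have hreal : ∀ A : Set Ω, P A ≤ ENNReal.ofReal (1 / (2 * n)) → P.real A ≤ 1 / (2 * n) :=
    fun A hA => ENNReal.toReal_le_of_le_ofReal (by positivity) hA
  have h6 := measureReal_mono (μ := P) hcover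
  rw [probReal_univ] at h6
  have h7 := h6.trans ((measureReal_union_le _ _).trans
    (add_le_add_right (measureReal_union_le _ _) _))
  have h8 := hreal _ hspread
  have h9 := hreal _ h1
  have h10 : 1 / (n : ℝ) = 1 / (2 * n) + 1 / (2 * n) := by field_simp; norm_num
  linarith

end Loads

/-! ### Random hash functions are spread with high probability. -/

/-- Since `s ≤ 3 ^ (s - 1)`, one has `s ^ s ≤ (3 * s) ^ (s - 1) ≤ n ^ (s - 1)`. -/
lemma self_div_pow_le_inv {n s : ℕ} (hs : 1 ≤ s) (hsn : 3 * s ≤ n) :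
    ((s : ℝ) / n) ^ s ≤ 1 / n := by
  obtain ⟨a, rfl⟩ := Nat.exists_eq_add_of_le' hs
  have hn0 : (0 : ℝ) < n := by exact_mod_cast (by omega : 0 < n)
  have h1 : (a + 1) ^ (a + 1) ≤ n ^ a := by
    calc (a + 1) ^ (a + 1) = (a + 1) ^ a * (a + 1) := pow_succ _ _
      _ ≤ (a + 1) ^ a * 3 ^ a := by
          gcongr
          exact Nat.succ_le_of_lt (Nat.lt_pow_self (by norm_num))
      _ = (3 * (a + 1)) ^ a := by rw [mul_pow, mul_comm]
      _ ≤ n ^ a := Nat.pow_le_pow_left hsn a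
  rw [div_pow, div_le_div_iff₀ (by positivity) hn0, one_mul, pow_succ (n : ℝ)]
  gcongr
  exact_mod_cast h1

/-- The union bound over the sets of a given small size in the case of two or more choices. -/
lemma choose_mul_exp_le {n s : ℕ} (hs : 1 ≤ s) (hsn : 3 * s ≤ n) :
    (n.choose s : ℝ) * Real.exp (5 * s - Real.log (n / s) * (11 * s)) ≤ 1 / (n : ℝ) ^ 4 := by
  have hn0 : (0 : ℝ) < n := by exact_mod_cast (by omega : 0 < n)
  have hs0 : (0 : ℝ) < s := by exact_mod_cast hs
  set x : ℝ := (s : ℝ) / n with hx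
  have hx0 : 0 < x := by positivity
  have hx3 : x ≤ 1 / 3 := by
    rw [hx, div_le_div_iff₀ hn0 (by norm_num)]
    have : ((3 * s : ℕ) : ℝ) ≤ n := by exact_mod_cast hsn
    push_cast at this
    linarith
  have hexp : Real.exp (5 * s - Real.log (n / s) * (11 * s))
      = Real.exp s ^ 5 * (x ^ s) ^ 11 := by
    rw [show (n : ℝ) / s = x⁻¹ by rw [hx, inv_div], Real.log_inv,
      show 5 * (s : ℝ) - -Real.log x * (11 * s) = (5 : ℕ) * s + ((11 * s : ℕ) : ℝ) * Real.log x by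
        push_cast; ring,
      Real.exp_add, Real.exp_nat_mul, Real.exp_nat_mul, Real.exp_log hx0, ← pow_mul, mul_comm 11]
  have hchoose : (n.choose s : ℝ) * x ^ s ≤ Real.exp s := by
    calc (n.choose s : ℝ) * x ^ s ≤ (n : ℝ) ^ s / (s.factorial : ℝ) * x ^ s := by
          gcongr
          exact Nat.choose_le_pow_div s n
      _ = (s : ℝ) ^ s / (s.factorial : ℝ) := by rw [hx, div_pow]; field_simp
      _ ≤ Real.exp s := Real.pow_div_factorial_le_exp _ hs0.le s
  have hex : Real.exp s * x ^ s ≤ 1 := by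
    rw [← mul_one (s : ℝ), Real.exp_nat_mul, ← mul_pow]
    refine pow_le_one₀ (by positivity) ?_
    have := Real.exp_one_lt_d9
    nlinarith [Real.exp_pos 1]
  rw [hexp]
  -- The eleven factors `x ^ s` split as `1 + 6 + 4`: one turns the binomial coefficient into `exp
  -- s`, six cancel the resulting `exp s ^ 6` because `exp 1 * x ≤ 1`, and four give `n ^ (-4)`.
  calc (n.choose s : ℝ) * (Real.exp s ^ 5 * (x ^ s) ^ 11)
      = (n.choose s * x ^ s) * (Real.exp s ^ 5 * (x ^ s) ^ 6) * (x ^ s) ^ 4 := by ring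
    _ ≤ Real.exp s * (Real.exp s ^ 5 * (x ^ s) ^ 6) * (x ^ s) ^ 4 := by gcongr
    _ = (Real.exp s * x ^ s) ^ 6 * (x ^ s) ^ 4 := by ring
    _ ≤ 1 ^ 6 * (1 / n) ^ 4 := by
        gcongr
        exact self_div_pow_le_inv hs hsn
    _ = _ := by rw [one_pow, one_mul, one_div_pow]

lemma one_le_log_div_log_log {n : ℕ} (hn : 3 ≤ n) :
    0 < Real.log (Real.log n) ∧ 1 ≤ Real.log n / Real.log (Real.log n) := by
  have hn3 : (3 : ℝ) ≤ n := by exact_mod_cast hn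
  have h1 : 1 < Real.log n := by
    rw [Real.lt_log_iff_exp_lt (by linarith)]
    linarith [Real.exp_one_lt_d9]
  have h2 := Real.log_pos h1
  refine ⟨h2, ?_⟩
  rw [one_le_div h2]
  linarith [Real.log_le_sub_one_of_pos (zero_lt_one.trans h1)]

section Hash

variable {n d : ℕ} {κ : Type u} [MeasurableSpace κ] {p : PMF κ} {Ω : Type v} [MeasurableSpace Ω] {P : Measure Ω}
  [IsProbabilityMeasure P] {H : Fin d → κ → Ω → Fin n} {X : ℕ → Ω → κ}
  {T : List (Fin n) → (Fin d → Fin n) → Ω → Fin n}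

lemma IsGreedyInput.measureReal_iInter_preimage (hin : IsGreedyInput p P H X T)
    (S : Finset (Fin n)) (k : κ) :
    P.real (⋂ i, H i k ⁻¹' (S : Set (Fin n))) = ((S.card : ℝ) / n) ^ d := by
  have hS : MeasurableSet (S : Set (Fin n)) := S.measurableSet
  have hpre : ∀ i, P.real (H i k ⁻¹' (S : Set (Fin n))) = (S.card : ℝ) / n := by
    intro i
    have h1 : P.real (H i k ⁻¹' (S : Set (Fin n))) = ∑ b ∈ S, P.real (H i k ⁻¹' {b}) := by
      have h2 := sum_measure_preimage_singleton (μ := P) S (f := H i k)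
        fun y _ => hin.measurable_hash i k (measurableSet_singleton y)
      rw [measureReal_def, ← h2, ENNReal.toReal_sum fun _ _ => measure_ne_top _ _]
      rfl
    have h3 : ∀ b, P.real (H i k ⁻¹' {b}) = 1 / n := hin.hash_uniform i k
    simp [h1, h3, div_eq_mul_inv]
  have hind : iIndepFun (fun i => H i k) P :=
    hin.hash_indep.precomp (g := fun i => (i, k)) fun i j h => (Prod.mk.inj h).1
  have h1 := hind.meas_iInter (s := fun i => H i k ⁻¹' (S : Set (Fin n)))
    fun i => ⟨S, hS, rfl⟩
  rw [measureReal_def, h1, ENNReal.toReal_prod]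
  simp_rw [← measureReal_def, hpre]
  rw [Finset.prod_const, Finset.card_univ, Fintype.card_fin]

variable [Countable κ] [MeasurableSingletonClass κ]

lemma IsGreedyInput.captured_mass_tail (hin : IsGreedyInput p P H X T) (hn : 1 ≤ n)
    (hp : ∀ k, (p k).toReal ≤ 1 / (5 * (n : ℝ))) (S : Finset (Fin n)) {r t : ℝ}
    (hr : ((S.card : ℝ) / n) ^ d ≤ r) (ht : 0 ≤ t) (R : ℝ) :
    P {ω | ENNReal.ofReal (R / (5 * n)) < p.toMeasure {k | ∀ i, H i k ω ∈ S}} ≤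
      ENNReal.ofReal (Real.exp (5 * n * r * Real.exp t - t * R)) := by
  have hn0 : (0 : ℝ) < n := by exact_mod_cast hn
  set A : Fin d × κ → Set Ω := fun x => H x.1 x.2 ⁻¹' (S : Set (Fin n)) with hA
  have hAm : ∀ x, MeasurableSet (A x) := fun x => hin.measurable_hash _ _ S.measurableSet
  have hAind : iIndepSet A P := by
    rw [iIndepSet_iff_meas_biInter hAm]
    intro F
    exact hin.hash_indep.meas_biInter fun x _ => ⟨S, S.measurableSet, rfl⟩
  have h := chernoff_pmf p (fun k => MeasurableSet.iInter fun i => hAm (i, k))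
    (iIndepSet_iInter hAm hAind) (by positivity) hp
    (fun k => (hin.measureReal_iInter_preimage S k).trans_le hr)
    ((by positivity : (0 : ℝ) ≤ ((S.card : ℝ) / n) ^ d).trans hr) ht R
  simpa [hA] using h

/-- With one choice the captured mass is additive in the bins, so only singletons need a tail bound.
-/
lemma IsGreedyInput.isSpread_of_one_choice {H : Fin 1 → κ → Ω → Fin n}
    {T : List (Fin n) → (Fin 1 → Fin n) → Ω → Fin n}
    (hin : IsGreedyInput p P H X T) (hn : 3 ≤ n)
    (hp : ∀ k, (p k).toReal ≤ 1 / (5 * (n : ℝ))) :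
    P {ω | ¬ IsSpread p (ENNReal.ofReal (2 * (Real.log n / Real.log (Real.log n)) / n))
      fun i k => H i k ω} ≤ ENNReal.ofReal (1 / (2 * n)) := by
  have hn3 : (3 : ℝ) ≤ n := by exact_mod_cast hn
  have hn0 : (0 : ℝ) < n := by linarith
  obtain ⟨hll, hQ⟩ := one_le_log_div_log_log hn
  set Q := Real.log n / Real.log (Real.log n) with hQdef
  have hlog : 0 < Real.log n := Real.log_pos (by linarith)
  set δ := ENNReal.ofReal (2 * Q / n) with hδ
  set B : Fin n → Set Ω := fun j => {ω | δ < p.toMeasure {k | ∀ i, H i k ω ∈ ({j} : Finset _)}}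
  have hsub : {ω | ¬ IsSpread p δ fun i k => H i k ω} ⊆ ⋃ j, B j := by
    intro ω hω
    by_contra hcon
    simp only [B, Set.mem_iUnion, Set.mem_ofPred_eq, not_exists, not_lt] at hcon
    refine hω fun S => ?_
    have hunion : {k | ∀ i, H i k ω ∈ S} = ⋃ j ∈ S, {k | ∀ i, H i k ω ∈ ({j} : Finset _)} := by
      ext k
      simp [Fin.forall_fin_one]
    rw [hunion]
    refine (measure_biUnion_finset_le _ _).trans ?_
    refine (Finset.sum_le_sum fun j _ => hcon j).trans_eq ?_
    simp [mul_comm]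
  have hB : ∀ j, P (B j) ≤ ENNReal.ofReal (1 / (n : ℝ) ^ 5) := by
    intro j
    -- With `exp t = log n` and `t * R = 10 * log n`, the Chernoff exponent is `5 * log n - 10 * log
    -- n = -5 * log n`.
    have h := hin.captured_mass_tail (by omega) hp {j} (r := 1 / n) (t := Real.log (Real.log n))
      (by simp) hll.le (10 * Q)
    have e1 : 10 * Q / (5 * n) = 2 * Q / n := by field_simp; norm_num
    have e2 : Real.exp (5 * n * (1 / n) * Real.exp (Real.log (Real.log n))
        - Real.log (Real.log n) * (10 * Q)) = 1 / (n : ℝ) ^ 5 := by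
      rw [Real.exp_log hlog, show 5 * (n : ℝ) * (1 / n) * Real.log n
        - Real.log (Real.log n) * (10 * Q) = -((5 : ℕ) * Real.log n) by
          rw [hQdef]; field_simp; push_cast; ring, Real.exp_neg, Real.exp_nat_mul,
        Real.exp_log hn0, one_div]
    rwa [e1, e2] at h
  refine (measure_mono hsub).trans ((measure_iUnion_fintype_le _ _).trans ?_)
  refine (Finset.sum_le_sum fun j _ => hB j).trans ?_
  rw [Finset.sum_const, Finset.card_univ, Fintype.card_fin, nsmul_eq_mul,
    ← ENNReal.ofReal_natCast, ← ENNReal.ofReal_mul hn0.le]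
  refine ENNReal.ofReal_le_ofReal ?_
  rw [mul_one_div, div_le_div_iff₀ (by positivity) (by positivity)]
  have h2 : (2 : ℝ) ≤ n ^ 3 := by nlinarith [pow_le_pow_left₀ (by norm_num) hn3 3]
  nlinarith [mul_le_mul_of_nonneg_right h2 (by positivity : (0 : ℝ) ≤ n * n)]

/-- Sets with at least a third of the bins satisfy the bound trivially, because `3 * #S / n ≥ 1`;
smaller ones are handled by a union bound over each size. -/
lemma IsGreedyInput.isSpread_of_two_le (hin : IsGreedyInput p P H X T) (hn : 2 ≤ n) (hd : 2 ≤ d)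
    (hp : ∀ k, (p k).toReal ≤ 1 / (5 * (n : ℝ))) :
    P {ω | ¬ IsSpread p (ENNReal.ofReal (3 / n)) fun i k => H i k ω}
      ≤ ENNReal.ofReal (1 / (2 * n)) := by
  classical
  have hn2 : (2 : ℝ) ≤ n := by exact_mod_cast hn
  have hn0 : (0 : ℝ) < n := by linarith
  set δ := ENNReal.ofReal (3 / n) with hδ
  set B : Finset (Fin n) → Set Ω := fun S =>
    {ω | δ * S.card < p.toMeasure {k | ∀ i, H i k ω ∈ S}} with hB
  have hsub : {ω | ¬ IsSpread p δ fun i k => H i k ω} ⊆ ⋃ S, B S := by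
    intro ω hω
    simpa [IsSpread, B] using hω
  set g : ℕ → ℝ := fun s => if 1 ≤ s ∧ 3 * s ≤ n then
    Real.exp (5 * s - Real.log (n / s) * (11 * s)) else 0 with hg
  have hg0 : ∀ s, 0 ≤ g s := fun s => by
    simp only [hg]
    split_ifs <;> positivity
  have hδS : ∀ S : Finset (Fin n), δ * S.card = ENNReal.ofReal (3 * S.card / n) := fun S => by
    rw [hδ, ← ENNReal.ofReal_natCast, ← ENNReal.ofReal_mul (by positivity)]
    congr 1
    ring
  have hBle : ∀ S, P (B S) ≤ ENNReal.ofReal (g S.card) := by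
    intro S
    by_cases hs : 1 ≤ S.card ∧ 3 * S.card ≤ n
    · have hs0 : (0 : ℝ) < S.card := by exact_mod_cast hs.1
      have hsn : (S.card : ℝ) ≤ n := by exact_mod_cast (by omega : S.card ≤ n)
      -- The choice `exp t = n / #S` cancels one factor `#S / n` of the capture probability, leaving
      -- `5 * #S`. The threshold `11 * #S / (5 * n)` is below `3 * #S / n`.
      have h := hin.captured_mass_tail (by omega) hp S (r := ((S.card : ℝ) / n) ^ 2)
        (t := Real.log (n / S.card))
        (pow_le_pow_of_le_one (by positivity) ((div_le_one hn0).2 hsn) hd)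
        (Real.log_nonneg ((one_le_div hs0).2 hsn)) (11 * S.card)
      have e1 : 5 * (n : ℝ) * ((S.card : ℝ) / n) ^ 2 * Real.exp (Real.log (n / S.card))
          = 5 * S.card := by
        rw [Real.exp_log (by positivity)]
        field_simp
      rw [e1] at h
      simp only [hg, if_pos hs]
      refine (measure_mono fun ω hω => ?_).trans h
      refine lt_of_le_of_lt ?_ (Set.mem_ofPred.1 hω)
      rw [hδS]
      refine ENNReal.ofReal_le_ofReal ?_
      rw [div_le_div_iff₀ (by positivity) hn0]
      nlinarith
    · have hempty : B S = ∅ := by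
        refine Set.eq_empty_of_forall_notMem fun ω hω => ?_
        refine absurd (Set.mem_ofPred.1 hω) (not_lt.2 ?_)
        rcases S.eq_empty_or_nonempty with rfl | hne
        · have : {k : κ | ∀ i, H i k ω ∈ (∅ : Finset (Fin n))} = ∅ :=
            Set.eq_empty_of_forall_notMem fun k hk =>
              Finset.notMem_empty _ (Set.mem_ofPred.1 hk ⟨0, by omega⟩)
          rw [this]
          simp
        · have hs1 := hne.card_pos
          have hs3 : (n : ℝ) ≤ 3 * S.card := by exact_mod_cast (by omega : n ≤ 3 * S.card)
          refine prob_le_one.trans ?_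
          rw [hδS, ENNReal.one_le_ofReal]
          exact (one_le_div hn0).2 hs3
      simp [hempty]
  refine (measure_mono hsub).trans ((measure_iUnion_fintype_le _ _).trans ?_)
  refine (Finset.sum_le_sum fun S _ => hBle S).trans ?_
  rw [← ENNReal.ofReal_sum_of_nonneg fun S _ => hg0 _, ← Finset.powerset_univ,
    Finset.sum_powerset_apply_card, Finset.card_univ, Fintype.card_fin]
  refine ENNReal.ofReal_le_ofReal ?_
  have hterm : ∀ s ∈ Finset.range (n + 1), n.choose s • g s ≤ 1 / (n : ℝ) ^ 4 := by
    intro s _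
    by_cases hs : 1 ≤ s ∧ 3 * s ≤ n
    · simp only [hg, if_pos hs, nsmul_eq_mul]
      exact choose_mul_exp_le hs.1 hs.2
    · simp only [hg, if_neg hs, smul_zero]
      positivity
  -- There are `n + 1` sizes, and `(n + 1) / n ^ 4 ≤ 1 / (2 * n)` once `n ≥ 2`.
  refine (Finset.sum_le_sum hterm).trans ?_
  rw [Finset.sum_const, Finset.card_range, nsmul_eq_mul, mul_one_div,
    div_le_div_iff₀ (by positivity) (by positivity)]
  push_cast
  have h2 : 2 * ((n : ℝ) + 1) ≤ n ^ 3 := by nlinarith [mul_nonneg hn0.le (sub_nonneg.2 hn2)]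
  nlinarith [mul_le_mul_of_nonneg_right h2 hn0.le]

end Hash

end PartialKeyGrouping

theorem theorem1 :
    ∃ C : ℝ, 0 < C ∧
      ∀ (n m d : ℕ) (κ : Type u) [Countable κ] [MeasurableSpace κ] [MeasurableSingletonClass κ]
        (p : PMF κ) (Ω : Type v) [MeasurableSpace Ω] (P : Measure Ω) [IsProbabilityMeasure P]
        (H : Fin d → κ → Ω → Fin n) (X : ℕ → Ω → κ)
        (T : List (Fin n) → (Fin d → Fin n) → Ω → Fin n),
        1 ≤ n → n ^ 2 ≤ m → (∀ k, (p k).toReal ≤ 1 / (5 * (n : ℝ))) →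
        PartialKeyGrouping.IsGreedyInput p P H X T →
        (d = 1 → 3 ≤ n →
          1 - 1 / (n : ℝ) ≤ P.real {ω | PartialKeyGrouping.greedyImbalance H X T m ω ≤
            C * ((m : ℝ) / n * (Real.log n / Real.log (Real.log n)))}) ∧
        (2 ≤ d →
          1 - 1 / (n : ℝ) ≤ P.real {ω | PartialKeyGrouping.greedyImbalance H X T m ω ≤
            C * ((m : ℝ) / n)}) := by
  -- The argument needs `2 * c + 3`: with `Q = ln n / ln ln n ≥ 1` this is `4 * Q + 3 ≤ 7 * Q` for
  -- one choice, and it is `9` for two or more.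
  refine ⟨10, by norm_num, ?_⟩
  intro n m d κ _ _ _ p Ω _ P _ H X T hn hm hp hin
  have hmn : (0 : ℝ) ≤ (m : ℝ) / n := by positivity
  constructor
  · rintro rfl hn3
    obtain ⟨-, hQ⟩ := PartialKeyGrouping.one_le_log_div_log_log hn3
    refine hin.imbalance_le_of_isSpread hn hm (by positivity) ?_
      (hin.isSpread_of_one_choice hn3 hp)
    nlinarith [mul_nonneg hmn (sub_nonneg.2 hQ)]
  · intro hd
    -- For `n = 1` the required probability `1 - 1 / n` is zero.
    rcases hn.eq_or_lt with rfl | hn2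
    · simp
    · refine hin.imbalance_le_of_isSpread hn hm (by norm_num) ?_ (hin.isSpread_of_two_le hn2 hd hp)
      nlinarith
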